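/- Let $G$ be a countable discrete amenable group, and call a sequence $\mathcal F=(F_n)_{n\in\mathbb N}$ of nonempty finite subsets of $G$ a Følner sequence if $|F_n\,\Delta\, gF_n|/|F_n|\to 0$ for every $g\in G$; amenability of $G$ means that a Følner sequence exists. Let $G$ act by homeomorphisms on compact metric spaces $X$ and $Y$, and let $\pi\colon X\to Y$ be a factor map, i.e. a continuous surjection with $\pi(g.x)=g.\pi(x)$ for all $g\in G$, $x\in X$. For an action of $G$ on a compact metric space $(Z,d)$, the Weyl pseudometric is $$D(z,z')=\sup_{\mathcal F}\ \limsup_{n\to\infty}\frac1{|F_n|}\sum_{g\in F_n}d(g.z,g.z'),$$ where the supremum is taken over all Følner sequences $\mathcal F=(F_n)$ in $G$, and a pair $(z,z')\in Z^2$ is called Banach proximal if $D(z,z')=0$. The map $\pi$ is called Banach proximal if every pair $(x,x')\in X^2$ with $\pi(x)=\pi(x')$ is Banach proximal. It is called topo-isomorphic if for every $G$-invariant Borel probability measure $\mu$ on $X$ the map $\pi$ is a measure-theoretic isomorphism from $(X,\mu)$ to $(Y,\pi_*\mu)$, i.e. there are Borel sets $A\subseteq X$ and $B\subseteq Y$ with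 $\mu(A)=1=\pi_*\mu(B)$ such that $\pi$ restricts to a bi-measurable bijection $A\to B$. **Theorem.** The following statements are equivalent. 1. $\pi$ is topo-isomorphic. 2. $\pi$ is Banach proximal. 3. For all $(x,x')\in X^2$, if $(\pi(x),\pi(x'))$ is Banach proximal, then $(x,x')$ is Banach proximal. -/

import Mathlib

open Filter Topology MeasureTheory
open scoped Pointwise symmDiff

noncomputable section

namespace WeylFactor

open Classical in
/-- A (left) Følner sequence of a discrete group: nonempty finite sets `F n` with
`|F n ∆ g F n| / |F n| → 0` for every `g`. -/
def IsFolnerSeq {G : Type*} [Group G] (F : ℕ → Finset G) : Prop :=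
  (∀ n, (F n).Nonempty) ∧
    ∀ g : G, Tendsto (fun n => (((F n) ∆ (g • F n)).card : ℝ) / ((F n).card : ℝ)) atTop (𝓝 0)

/-- Amenability of a countable discrete group: existence of a Følner sequence. -/
def IsAmenable (G : Type*) [Group G] : Prop :=
  ∃ F : ℕ → Finset G, IsFolnerSeq F

/-- The Besicovitch pseudometric along the sequence `F`, for the metric of `X`. On a compact space
the averages lie in `[0, diam X]`, so that the real `limsup` is the true one. -/
def besicovitchDist {G X : Type*} [Group G] [MetricSpace X] [MulAction G X]
    (F : ℕ → Finset G) (x x' : X) : ℝ :=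
  limsup (fun n => (1 / ((F n).card : ℝ)) * ∑ g ∈ F n, dist (g • x) (g • x')) atTop

/-- The Weyl pseudometric: the supremum of the Besicovitch pseudometrics over all Følner sequences.
For an amenable group acting on a compact space, this is the supremum of a nonempty set of reals
that is bounded by `diam X`. -/
def weylDist (G : Type*) {X : Type*} [Group G] [MetricSpace X] [MulAction G X] (x x' : X) : ℝ :=
  ⨆ F : {F : ℕ → Finset G // IsFolnerSeq F}, besicovitchDist F.1 x x'

/-- The pair `(x, x')` is Banach proximal. -/
def BanachProximal (G : Type*) {X : Type*} [Group G] [MetricSpace X] [MulAction G X]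
    (x x' : X) : Prop :=
  weylDist G x x' = 0

/-- Factor maps: continuous equivariant surjections. -/
structure IsFactorMap (G : Type*) {X Y : Type*} [Group G] [TopologicalSpace X]
    [TopologicalSpace Y] [MulAction G X] [MulAction G Y] (π : X → Y) : Prop where
  continuous : Continuous π
  surjective : Function.Surjective π
  map_smul : ∀ (g : G) (x : X), π (g • x) = g • π x

/-- `π` is Banach proximal: all pairs in `R(π) = {(x, x') | π x = π x'}` are Banach proximal. -/
def IsBanachProximalMap (G : Type*) {X Y : Type*} [Group G] [MetricSpace X] [MulAction G X]
    (π : X → Y) : Prop :=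
  ∀ x x' : X, π x = π x' → BanachProximal G x x'

/-- `π` is topo-isomorphic: for each invariant Borel probability measure `μ` on `X`, the map `π` is
a measure-theoretic isomorphism from `(X, μ)` onto `(Y, π_* μ)`, i.e. it restricts to a
bi-measurable bijection between Borel sets of full measure. -/
def IsTopoIsomorphic (G : Type*) {X Y : Type*} [Group G] [MeasurableSpace X] [MeasurableSpace Y]
    [MulAction G X] (π : X → Y) : Prop :=
  ∀ μ : Measure X, IsProbabilityMeasure μ → SMulInvariantMeasure G X μ →
    ∃ (A : Set X) (B : Set Y), MeasurableSet A ∧ MeasurableSet B ∧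
      μ A = 1 ∧ (μ.map π) B = 1 ∧ ∃ e : A ≃ᵐ B, ∀ x : A, (e x : Y) = π x

end WeylFactor

end

/-!
The three conditions are compared through invariant measures on pairs. A pair is Banach proximal
when the orbit averages of the distance tend to zero along every Følner sequence
(`banachProximal_iff_tendsto`).

If `π` is topo-isomorphic and `(π x, π x')` is Banach proximal, take any limit `ρ` of the empirical
measures of the orbit of `(x, x')` along a Følner sequence. It is invariant
(`exists_invariant_limit`), and the distance of the images integrates to zero, so `ρ` lives on the
fibre product of `X` with itself over `Y`. As `π` is injective on a set that is conull for both
marginals, `ρ` lives on the diagonal (`IsTopoIsomorphic.ae_eq_of_ae_map_eq`); hence the limit of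
the averages of the distance at `(x, x')` is zero. Applied to pairs with `π x = π x'`, this lifting
property says that `π` is Banach proximal.

Conversely, an invariant measure on pairs that charges only Banach proximal pairs lives on the
diagonal: the integral of the distance is that of its orbit averages, which tend to zero
(`ae_eq_of_ae_banachProximal`). For a Banach proximal `π` and an invariant `μ` this applies to the
relatively independent self-joining of `μ` over `Y`. That joining lives on the diagonal only if the
disintegration of `μ` over `π` consists of point masses, and the positions of these point masses
give a measurable almost everywhere inverse of `π`
(`exists_measurable_section_of_joining_diagonal`).
-/

open Filter Topology MeasureTheory ProbabilityTheory
open scoped Pointwise symmDiff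

namespace WeylFactor

/-! ### Orbit averages and Banach proximality -/

/-- The average of `f` along the finite piece `F • z` of the orbit of `z`. -/
noncomputable def orbitAverage {G Z : Type*} [Group G] [MulAction G Z] (F : Finset G)
    (f : Z → ℝ) (z : Z) : ℝ :=
  (1 / (F.card : ℝ)) * ∑ g ∈ F, f (g • z)

section Average

variable {G Z : Type*} [Group G] [MulAction G Z]

lemma orbitAverage_nonneg (F : Finset G) {f : Z → ℝ} (hf : ∀ z, 0 ≤ f z) (z : Z) :
    0 ≤ orbitAverage F f z :=
  mul_nonneg (by positivity) (Finset.sum_nonneg fun _ _ => hf _)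

lemma orbitAverage_le {F : Finset G} (hF : F.Nonempty) {f : Z → ℝ} {C : ℝ} (hf : ∀ z, f z ≤ C)
    (z : Z) : orbitAverage F f z ≤ C := by
  have hc : (0 : ℝ) < F.card := by exact_mod_cast hF.card_pos
  have h : ∑ g ∈ F, f (g • z) ≤ F.card * C := by
    simpa using Finset.sum_le_card_nsmul F _ C fun g _ => hf (g • z)
  rw [orbitAverage, one_div, inv_mul_le_iff₀ hc]
  exact h

open Classical in
lemma abs_sum_sub_sum_le_card_symmDiff {ι : Type*} (A B : Finset ι) {u : ι → ℝ} {C : ℝ}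
    (hu : ∀ i, |u i| ≤ C) : |∑ i ∈ A, u i - ∑ i ∈ B, u i| ≤ C * (A ∆ B).card := by
  have h1 : ∑ i ∈ A, u i - ∑ i ∈ B, u i = ∑ i ∈ A \ B, u i - ∑ i ∈ B \ A, u i := by
    rw [← Finset.sum_inter_add_sum_sdiff A B, ← Finset.sum_inter_add_sum_sdiff B A,
      Finset.inter_comm B A]
    ring
  have h2 : ∀ S : Finset ι, |∑ i ∈ S, u i| ≤ C * S.card := fun S => by
    refine (Finset.abs_sum_le_sum_abs _ _).trans ?_
    simpa [mul_comm] using Finset.sum_le_card_nsmul S _ C fun i _ => hu i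
  have h3 : (A ∆ B).card = (A \ B).card + (B \ A).card := by
    rw [symmDiff_def]
    exact Finset.card_union_of_disjoint disjoint_sdiff_sdiff
  rw [h1, h3]
  push_cast
  calc |∑ i ∈ A \ B, u i - ∑ i ∈ B \ A, u i|
      ≤ |∑ i ∈ A \ B, u i| + |∑ i ∈ B \ A, u i| := abs_sub _ _
    _ ≤ _ := by linarith [h2 (A \ B), h2 (B \ A)]

/-- The averages of `f` and of its translate by `h` differ only over `F ∆ hF`. -/
lemma abs_orbitAverage_smul_sub_le (F : Finset G) (h : G) {f : Z → ℝ} {C : ℝ}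
    (hf : ∀ z, |f z| ≤ C) (z : Z) :
    |orbitAverage F f z - orbitAverage F (fun w => f (h • w)) z| ≤
      C * ((open Classical in ((F ∆ (h • F)).card : ℝ)) / (F.card : ℝ)) := by
  classical
  have h1 : ∑ g ∈ F, f (h • g • z) = ∑ g ∈ h • F, f (g • z) := by
    rw [← Finset.image_smul, Finset.sum_image fun a _ b _ hab => by simpa using hab]
    simp [mul_smul]
  have h2 := abs_sum_sub_sum_le_card_symmDiff F (h • F) (u := fun g => f (g • z)) fun _ => hf _
  rw [orbitAverage, orbitAverage, h1, ← mul_sub, abs_mul, abs_of_nonneg (by positivity)]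
  calc _ ≤ 1 / (F.card : ℝ) * _ := mul_le_mul_of_nonneg_left h2 (by positivity)
    _ = _ := by
      rw [one_div, div_eq_mul_inv]
      ring

end Average

section Proximal

variable {G X : Type*} [Group G] [MetricSpace X] [CompactSpace X] [MulAction G X]

lemma dist_le_diam_univ (p : X × X) : dist p.1 p.2 ≤ Metric.diam (Set.univ : Set X) :=
  Metric.dist_le_diam_of_mem isCompact_univ.isBounded (Set.mem_univ _) (Set.mem_univ _)

/-- The averages are nonnegative and bounded by the diameter, so the real `limsup` and `⨆` in
`weylDist` take no junk values, and vanishing of the supremum is convergence along every sequence. -/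
lemma banachProximal_iff_tendsto (x x' : X) : BanachProximal G x x' ↔
    ∀ F : ℕ → Finset G, IsFolnerSeq F →
      Tendsto (fun n => orbitAverage (F n) (fun p : X × X => dist p.1 p.2) (x, x'))
        atTop (𝓝 0) := by
  have hle : ∀ F : ℕ → Finset G, IsFolnerSeq F → ∀ n,
      orbitAverage (F n) (fun p : X × X => dist p.1 p.2) (x, x') ≤
        Metric.diam (Set.univ : Set X) := fun F hF n =>
    orbitAverage_le (hF.1 n) dist_le_diam_univ _
  have hnn : ∀ (F : ℕ → Finset G) n,
      0 ≤ orbitAverage (F n) (fun p : X × X => dist p.1 p.2) (x, x') := fun F n =>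
    orbitAverage_nonneg _ (fun _ => dist_nonneg) _
  have hbes : ∀ F : ℕ → Finset G, besicovitchDist F x x' =
      limsup (fun n => orbitAverage (F n) (fun p : X × X => dist p.1 p.2) (x, x')) atTop :=
    fun _ => rfl
  have hbu : ∀ F : ℕ → Finset G, IsFolnerSeq F → IsBoundedUnder (· ≤ ·) atTop
      (fun n => orbitAverage (F n) (fun p : X × X => dist p.1 p.2) (x, x')) := fun F hF =>
    isBoundedUnder_of ⟨_, hle F hF⟩
  have hbl : ∀ F : ℕ → Finset G, IsBoundedUnder (· ≥ ·) atTop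
      (fun n => orbitAverage (F n) (fun p : X × X => dist p.1 p.2) (x, x')) := fun F =>
    isBoundedUnder_of ⟨0, hnn F⟩
  constructor
  · intro h F hF
    have hbdd : BddAbove (Set.range fun F : {F : ℕ → Finset G // IsFolnerSeq F} =>
        besicovitchDist F.1 x x') := by
      refine ⟨Metric.diam (Set.univ : Set X), ?_⟩
      rintro _ ⟨F, rfl⟩
      exact limsup_le_of_le (hbl F.1).isCoboundedUnder_flip (Eventually.of_forall (hle F.1 F.2))
    have h0 : besicovitchDist F x x' ≤ 0 := (le_ciSup hbdd ⟨F, hF⟩).trans_eq h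
    exact tendsto_of_le_liminf_of_limsup_le
      (le_liminf_of_le (hbu F hF).isCoboundedUnder_flip (Eventually.of_forall (hnn F)))
      (hbes F ▸ h0) (hbu F hF) (hbl F)
  · intro h
    have : ∀ F : {F : ℕ → Finset G // IsFolnerSeq F}, besicovitchDist F.1 x x' = 0 :=
      fun F => (hbes F.1).trans (h F.1 F.2).limsup_eq
    simp [BanachProximal, weylDist, this]

lemma banachProximal_self (x : X) : BanachProximal G x x := by
  simp [banachProximal_iff_tendsto, orbitAverage]

end Proximal

/-! ### Invariant limits of empirical measures -/

section Limit

variable {G Z : Type*} [Group G] [MetricSpace Z] [CompactSpace Z] [MeasurableSpace Z]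
  [BorelSpace Z] [MulAction G Z]

/-- The uniform distribution on the finite piece `F • z` of an orbit, counted with multiplicity. -/
noncomputable def empiricalMeasure (F : Finset G) (hF : F.Nonempty) (z : Z) :
    ProbabilityMeasure Z :=
  ⟨(F.card : ENNReal)⁻¹ • ∑ g ∈ F, Measure.dirac (g • z), ⟨by
    have h0 : (F.card : ENNReal) ≠ 0 := by exact_mod_cast hF.card_pos.ne'
    simp [ENNReal.inv_mul_cancel h0 (ENNReal.natCast_ne_top _)]⟩⟩

lemma integral_empiricalMeasure (F : Finset G) (hF : F.Nonempty) (z : Z) {f : Z → ℝ}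
    (hf : Continuous f) :
    ∫ w, f w ∂(empiricalMeasure F hF z : Measure Z) = orbitAverage F f z := by
  have hs : StronglyMeasurable f := hf.stronglyMeasurable
  rw [empiricalMeasure, ProbabilityMeasure.coe_mk, integral_smul_measure,
    integral_finsetSum_measure fun g _ => integrable_dirac (by simp)]
  simp [orbitAverage]

/-- Limits of empirical measures along a Følner sequence are invariant. An ultrafilter stands in
for the passage to a convergent subsequence. -/
lemma exists_invariant_limit [ContinuousConstSMul G Z] {F : ℕ → Finset G} (hF : IsFolnerSeq F)
    (U : Ultrafilter ℕ) (hU : (U : Filter ℕ) ≤ atTop) (z : Z) :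
    ∃ μ : Measure Z, IsProbabilityMeasure μ ∧ SMulInvariantMeasure G Z μ ∧
      ∀ f : Z → ℝ, Continuous f →
        Tendsto (fun n => orbitAverage (F n) f z) U (𝓝 (∫ w, f w ∂μ)) := by
  obtain ⟨μ, -, hμ⟩ := isCompact_univ.ultrafilter_le_nhds
    (U.map fun n => empiricalMeasure (F n) (hF.1 n) z) (by simp)
  have hlim : ∀ f : Z → ℝ, Continuous f →
      Tendsto (fun n => orbitAverage (F n) f z) U (𝓝 (∫ w, f w ∂(μ : Measure Z))) := by
    intro f hf
    have := ProbabilityMeasure.tendsto_iff_forall_integral_tendsto.1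
      (show Tendsto (fun n => empiricalMeasure (F n) (hF.1 n) z) U (𝓝 μ) from hμ)
      (BoundedContinuousFunction.mkOfCompact ⟨f, hf⟩)
    simpa [integral_empiricalMeasure _ _ _ hf] using this
  refine ⟨μ, inferInstance, ⟨fun h s hs => ?_⟩, hlim⟩
  have hm : Measurable fun w : Z => h • w := (continuous_const_smul h).measurable
  have hmap : (μ : Measure Z).map (fun w => h • w) = μ := by
    have : IsProbabilityMeasure ((μ : Measure Z).map fun w => h • w) :=
      Measure.isProbabilityMeasure_map hm.aemeasurable
    refine ext_of_forall_integral_eq_of_IsFiniteMeasure fun f => ?_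
    rw [integral_map hm.aemeasurable f.continuous.aestronglyMeasurable]
    have hlim1 := hlim f f.continuous
    have hlim2 := hlim (fun w => f (h • w)) (f.continuous.comp (continuous_const_smul h))
    have h0 : Tendsto (fun n => orbitAverage (F n) f z -
        orbitAverage (F n) (fun w => f (h • w)) z) U (𝓝 0) := by
      refine squeeze_zero_norm
        (fun n => abs_orbitAverage_smul_sub_le (F n) h f.norm_coe_le_norm z) ?_
      simpa using ((hF.2 h).mono_left hU).const_mul ‖f‖
    have := tendsto_nhds_unique (hlim1.sub hlim2) h0
    linarith
  rw [← Measure.map_apply hm hs, hmap]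

end Limit

/-! ### Invariant measures on pairs -/

section Pairs

variable {G X : Type*} [Group G] [MetricSpace X] [MeasurableSpace X]
  [BorelSpace X] [MulAction G X]

lemma integral_orbitAverage {Z : Type*} [MeasurableSpace Z] [MulAction G Z]
    [MeasurableConstSMul G Z] {μ : Measure Z} [SMulInvariantMeasure G Z μ] {F : Finset G}
    (hF : F.Nonempty) {f : Z → ℝ} (hf : Integrable f μ) :
    ∫ z, orbitAverage F f z ∂μ = ∫ z, f z ∂μ := by
  have hc : (F.card : ℝ) ≠ 0 := by exact_mod_cast hF.card_pos.ne'
  have hp : ∀ g : G, MeasurePreserving (fun z : Z => g • z) μ μ := fun g =>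
    measurePreserving_smul g μ
  have he : ∀ g : G, ∫ z, f (g • z) ∂μ = ∫ z, f z ∂μ := fun g =>
    (hp g).integral_comp (measurableEmbedding_const_smul g) f
  simp only [orbitAverage]
  have hi : ∀ g ∈ F, Integrable (fun z => f (g • z)) μ := fun g _ =>
    (hp g).integrable_comp_of_integrable hf
  rw [integral_const_mul, integral_finsetSum _ hi]
  simp [he, hc]

lemma ae_eq_of_integral_dist_eq_zero [CompactSpace X] {ρ : Measure (X × X)} [IsProbabilityMeasure ρ]
    (h : ∫ p, dist p.1 p.2 ∂ρ = 0) : ∀ᵐ p ∂ρ, p.1 = p.2 := by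
  have hint : Integrable (fun p : X × X => dist p.1 p.2) ρ :=
    continuous_dist.integrable_of_hasCompactSupport (HasCompactSupport.of_compactSpace _)
  filter_upwards [(integral_eq_zero_iff_of_nonneg (fun _ => dist_nonneg) hint).1 h] with p hp
  exact dist_eq_zero.1 hp

/-- The integral of the distance equals that of its orbit averages, and these tend to zero. -/
lemma ae_eq_of_ae_banachProximal [CompactSpace X] [ContinuousConstSMul G X] (hG : IsAmenable G)
    {ρ : Measure (X × X)} [IsProbabilityMeasure ρ] [SMulInvariantMeasure G (X × X) ρ]
    (h : ∀ᵐ p ∂ρ, BanachProximal G p.1 p.2) : ∀ᵐ p ∂ρ, p.1 = p.2 := by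
  obtain ⟨F, hF⟩ := hG
  apply ae_eq_of_integral_dist_eq_zero
  have hint : Integrable (fun p : X × X => dist p.1 p.2) ρ :=
    continuous_dist.integrable_of_hasCompactSupport (HasCompactSupport.of_compactSpace _)
  have hlim : Tendsto (fun n => ∫ p, orbitAverage (F n) (fun p : X × X => dist p.1 p.2) p ∂ρ)
      atTop (𝓝 (∫ _, 0 ∂ρ)) := by
    refine tendsto_integral_of_dominated_convergence
      (fun _ => Metric.diam (Set.univ : Set X)) (fun n => ?_) (integrable_const _)
      (fun n => Eventually.of_forall fun p => ?_) ?_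
    · refine Continuous.aestronglyMeasurable ?_
      exact continuous_const.mul (continuous_finsetSum _ fun g _ =>
        continuous_dist.comp (continuous_const_smul g))
    · rw [Real.norm_of_nonneg (orbitAverage_nonneg _ (fun _ => dist_nonneg) _)]
      exact orbitAverage_le (hF.1 n) dist_le_diam_univ _
    · filter_upwards [h] with p hp
      exact (banachProximal_iff_tendsto p.1 p.2).1 hp F hF
  simp only [integral_orbitAverage (hF.1 _) hint, integral_zero] at hlim
  exact tendsto_nhds_unique tendsto_const_nhds hlim

/-- Both marginals live on the set where `π` is injective: apply the isomorphism property to their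
average. -/
lemma IsTopoIsomorphic.ae_eq_of_ae_map_eq [SecondCountableTopology X]
    [ContinuousConstSMul G X] {Y : Type*}
    [MeasurableSpace Y] {π : X → Y} (h : IsTopoIsomorphic G π)
    {ρ : Measure (X × X)} [IsProbabilityMeasure ρ] [SMulInvariantMeasure G (X × X) ρ]
    (hρ : ∀ᵐ p ∂ρ, π p.1 = π p.2) : ∀ᵐ p ∂ρ, p.1 = p.2 := by
  have hm1 : IsProbabilityMeasure (ρ.map Prod.fst) :=
    Measure.isProbabilityMeasure_map measurable_fst.aemeasurable
  have hm2 : IsProbabilityMeasure (ρ.map Prod.snd) :=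
    Measure.isProbabilityMeasure_map measurable_snd.aemeasurable
  have hpre : ∀ (g : G) (s : Set X), MeasurableSet s →
      ρ.map Prod.fst ((fun x => g • x) ⁻¹' s) = ρ.map Prod.fst s ∧
      ρ.map Prod.snd ((fun x => g • x) ⁻¹' s) = ρ.map Prod.snd s := by
    intro g s hs
    have hgs : MeasurableSet ((fun x : X => g • x) ⁻¹' s) := measurable_const_smul g hs
    rw [Measure.map_apply measurable_fst hgs, Measure.map_apply measurable_fst hs,
      Measure.map_apply measurable_snd hgs, Measure.map_apply measurable_snd hs]
    exact ⟨measure_preimage_smul_of_nullMeasurableSet (measurable_fst hs).nullMeasurableSet g,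
      measure_preimage_smul_of_nullMeasurableSet (measurable_snd hs).nullMeasurableSet g⟩
  have hprob : IsProbabilityMeasure
      ((2 : ENNReal)⁻¹ • (ρ.map Prod.fst + ρ.map Prod.snd)) := ⟨by
    simp [ENNReal.inv_two_add_inv_two]⟩
  obtain ⟨A, B, hA, -, hA1, -, e, he⟩ := h _ hprob ⟨fun g s hs => by
    simp [(hpre g s hs).1, (hpre g s hs).2]⟩
  have hA0 := (prob_compl_eq_zero_iff hA).2 hA1
  simp only [Measure.smul_apply, Measure.add_apply, smul_eq_mul, mul_eq_zero, add_eq_zero,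
    ENNReal.inv_eq_zero, ENNReal.ofNat_ne_top, false_or,
    Measure.map_apply measurable_fst hA.compl, Measure.map_apply measurable_snd hA.compl] at hA0
  have h1 : ∀ᵐ p ∂ρ, p.1 ∈ A := by
    rw [ae_iff]; exact hA0.1
  have h2 : ∀ᵐ p ∂ρ, p.2 ∈ A := by
    rw [ae_iff]; exact hA0.2
  filter_upwards [h1, h2, hρ] with p hp1 hp2 hp
  have : e ⟨p.1, hp1⟩ = e ⟨p.2, hp2⟩ := Subtype.ext (by rw [he, he, hp])
  simpa using e.injective this

end Pairs

/-! ### Banach proximality of lifts -/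

section Lift

variable {G X Y : Type*} [Group G]
  [MetricSpace X] [CompactSpace X] [MeasurableSpace X] [BorelSpace X]
  [MetricSpace Y] [CompactSpace Y] [MeasurableSpace Y]
  [MulAction G X] [ContinuousConstSMul G X] [MulAction G Y]

/-- A limit `ρ` of empirical measures of `(x, x')` projects to the diagonal of `Y`, hence lives on
the fibre product, where topo-isomorphism forces it onto the diagonal. -/
lemma IsTopoIsomorphic.banachProximal_of_map {π : X → Y} (hπ : IsFactorMap G π)
    (h : IsTopoIsomorphic G π) {x x' : X} (hxx : BanachProximal G (π x) (π x')) :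
    BanachProximal G x x' := by
  rw [banachProximal_iff_tendsto] at hxx ⊢
  intro F hF
  rw [tendsto_iff_ultrafilter]
  intro U hU
  obtain ⟨ρ, hρ, hinv, hlim⟩ := exists_invariant_limit (Z := X × X) hF U hU (x, x')
  have hlimX := hlim _ continuous_dist
  have hcY : Continuous fun p : X × X => dist (π p.1) (π p.2) :=
    (hπ.continuous.comp continuous_fst).dist (hπ.continuous.comp continuous_snd)
  have hlimY : Tendsto (fun n => orbitAverage (F n)
      (fun p : X × X => dist (π p.1) (π p.2)) (x, x')) U (𝓝 0) := by
    simpa [orbitAverage, hπ.map_smul] using (hxx F hF).mono_left hU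
  have hY0 := tendsto_nhds_unique (hlim _ hcY) hlimY
  have hint : Integrable (fun p : X × X => dist (π p.1) (π p.2)) ρ :=
    hcY.integrable_of_hasCompactSupport (HasCompactSupport.of_compactSpace _)
  have hR : ∀ᵐ p ∂ρ, π p.1 = π p.2 := by
    filter_upwards [(integral_eq_zero_iff_of_nonneg (fun _ => dist_nonneg) hint).1 hY0] with p hp
    exact dist_eq_zero.1 hp
  have h0 : ∫ p : X × X, dist p.1 p.2 ∂ρ = 0 := by
    refine integral_eq_zero_of_ae ?_
    filter_upwards [h.ae_eq_of_ae_map_eq hR] with p hp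
    simp [hp]
  rwa [h0] at hlimX

end Lift

/-! ### The relatively independent self-joining -/

section Joining

variable {G X Y : Type*} [Group G]
  [MeasurableSpace X] [StandardBorelSpace X] [Nonempty X] [MeasurableSpace Y]
  [MulAction G X] [MeasurableConstSMul G X] [MulAction G Y] [MeasurableConstSMul G Y]

/-- The disintegration of an invariant measure over an equivariant map is equivariant, because the
translate of the disintegration by `g` is again a disintegration. -/
lemma condDistrib_smul_ae_eq {π : X → Y} (hπm : Measurable π)
    (hπ : ∀ (g : G) (x : X), π (g • x) = g • π x) {μ : Measure X} [IsProbabilityMeasure μ]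
    [SMulInvariantMeasure G X μ] (g : G) :
    ∀ᵐ x ∂μ, condDistrib id π μ (π (g • x)) =
      (condDistrib id π μ (π x)).map (fun x' => g • x') := by
  have hgX : Measurable fun x : X => g • x := measurable_const_smul g
  have hgY : Measurable fun y : Y => g • y := measurable_const_smul g
  have hgY' : Measurable fun y : Y => g⁻¹ • y := measurable_const_smul g⁻¹
  have hp : MeasurePreserving (fun x : X => g • x) μ μ := measurePreserving_smul g μ
  have hpY : MeasurePreserving (fun y : Y => g • y) (μ.map π) (μ.map π) := by
    refine ⟨hgY, ?_⟩
    rw [Measure.map_map hgY hπm]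
    conv_rhs => rw [← hp.map_eq, Measure.map_map hπm hgX]
    congr 1
    ext x
    simp [hπ]
  have hν : IsProbabilityMeasure (μ.map π) := Measure.isProbabilityMeasure_map hπm.aemeasurable
  set κ := condDistrib (id : X → X) π μ with hκ
  have hcp : μ.map π ⊗ₘ κ = μ.map (fun x => (π x, x)) :=
    compProd_map_condDistrib measurable_id.aemeasurable
  -- The disintegration translated by `g`: the measure over `y` is the image of that over `g⁻¹ • y`.
  set κ' : Kernel Y X := (κ.comap _ hgY').map (fun x => g • x) with hκ'
  have hmk : IsMarkovKernel κ' := Kernel.IsMarkovKernel.map _ hgX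
  have happ : ∀ y, κ' y = (κ (g⁻¹ • y)).map fun x => g • x := fun y => by
    rw [hκ', Kernel.map_apply _ hgX, Kernel.comap_apply]
  have hdis : μ.map (fun x => (π x, x)) = μ.map π ⊗ₘ κ' := by
    have hpm : Measurable fun x : X => (π x, x) := hπm.prodMk measurable_id
    ext s hs
    have hgs : MeasurableSet ((fun q : Y × X => (g • q.1, g • q.2)) ⁻¹' s) :=
      ((hgY.comp measurable_fst).prodMk (hgX.comp measurable_snd)) hs
    rw [Measure.compProd_apply hs, ← hpY.lintegral_comp (Kernel.measurable_kernel_prodMk_left hs)]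
    have : ∀ y, κ' (g • y) (Prod.mk (g • y) ⁻¹' s) =
        κ y (Prod.mk y ⁻¹' ((fun q : Y × X => (g • q.1, g • q.2)) ⁻¹' s)) := fun y => by
      rw [happ, inv_smul_smul, Measure.map_apply hgX (measurable_prodMk_left hs)]
      rfl
    simp only [this]
    rw [← Measure.compProd_apply hgs, hcp, Measure.map_apply hpm hgs, Measure.map_apply hpm hs,
      ← hp.measure_preimage (hpm hs).nullMeasurableSet]
    congr 1
    ext x
    simp [hπ]
  have hae : κ =ᵐ[μ.map π] κ' :=
    condDistrib_ae_eq_of_measure_eq_compProd π measurable_id.aemeasurable hdis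
  filter_upwards [hp.quasiMeasurePreserving.ae (ae_of_ae_map hπm.aemeasurable hae)] with x hx
  rw [hx, happ, hπ, inv_smul_smul]

/-- The law of a pair `(x, x')`, where `x` has law `μ` and `x'` is drawn from the disintegration of
`μ` over `π`, independently of `x` given `π x`. -/
noncomputable def relIndepJoining {π : X → Y} (hπm : Measurable π) (μ : Measure X)
    [IsFiniteMeasure μ] : Measure (X × X) :=
  μ ⊗ₘ (condDistrib id π μ).comap π hπm

instance {π : X → Y} (hπm : Measurable π) (μ : Measure X) [IsProbabilityMeasure μ] :
    IsProbabilityMeasure (relIndepJoining hπm μ) := by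
  unfold relIndepJoining
  infer_instance

/-- Invariance for the diagonal action, from the equivariance of the disintegration. -/
lemma smulInvariantMeasure_relIndepJoining {π : X → Y} (hπm : Measurable π)
    (hπ : ∀ (g : G) (x : X), π (g • x) = g • π x) (μ : Measure X) [IsProbabilityMeasure μ]
    [SMulInvariantMeasure G X μ] :
    SMulInvariantMeasure G (X × X) (relIndepJoining hπm μ) := by
  refine ⟨fun g s hs => ?_⟩
  have hgX : Measurable fun x : X => g • x := measurable_const_smul g
  have hp : MeasurePreserving (fun x : X => g • x) μ μ := measurePreserving_smul g μ
  have hgp : Measurable fun p : X × X => g • p :=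
    (hgX.comp measurable_fst).prodMk (hgX.comp measurable_snd)
  rw [relIndepJoining, Measure.compProd_apply (hgp hs),
    Measure.compProd_apply hs, ← hp.lintegral_comp (Kernel.measurable_kernel_prodMk_left hs)]
  refine lintegral_congr_ae ?_
  filter_upwards [condDistrib_smul_ae_eq hπm hπ (μ := μ) g] with x hx
  rw [Kernel.comap_apply, Kernel.comap_apply, hx,
    Measure.map_apply hgX (measurable_prodMk_left hs)]
  rfl

lemma ae_relIndepJoining_map_eq [MeasurableEq Y] {π : X → Y} (hπm : Measurable π)
    (μ : Measure X) [IsProbabilityMeasure μ] :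
    ∀ᵐ p ∂(relIndepJoining hπm μ), π p.1 = π p.2 := by
  have hs : MeasurableSet {q : Y × X | q.1 = π q.2} :=
    measurableSet_eq_fun measurable_fst (hπm.comp measurable_snd)
  have hcp : μ.map π ⊗ₘ condDistrib id π μ = μ.map (fun x => (π x, x)) :=
    compProd_map_condDistrib measurable_id.aemeasurable
  have h1 : ∀ᵐ q ∂(μ.map π ⊗ₘ condDistrib id π μ), q.1 = π q.2 := by
    have hpm : Measurable fun x : X => (π x, x) := hπm.prodMk measurable_id
    rw [hcp, ae_map_iff hpm.aemeasurable hs]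
    exact Eventually.of_forall fun _ => rfl
  have hs' : MeasurableSet {p : X × X | π p.1 = π p.2} :=
    measurableSet_eq_fun (hπm.comp measurable_fst) (hπm.comp measurable_snd)
  rw [relIndepJoining, Measure.ae_compProd_iff hs']
  exact ae_of_ae_map hπm.aemeasurable (Measure.ae_ae_of_ae_compProd h1)

/-- If the relatively independent self-joining lives on the diagonal, then almost every measure of
the disintegration is a point mass, and its position is a measurable section of `π`. -/
lemma exists_measurable_section_of_joining_diagonal {π : X → Y} (hπm : Measurable π)
    {μ : Measure X} [IsProbabilityMeasure μ]
    (h : ∀ᵐ p ∂(relIndepJoining hπm μ), p.1 = p.2) :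
    ∃ s : Y → X, Measurable s ∧ ∀ᵐ x ∂μ, s (π x) = x := by
  have he := measurableEmbedding_embeddingReal X
  -- Integrating a Borel embedding into `ℝ` against a point mass gives its value at that point.
  refine ⟨fun y => he.invFun (∫ x, embeddingReal X x ∂(condDistrib id π μ y)),
    he.measurable_invFun.comp ?_, ?_⟩
  · exact (StronglyMeasurable.integral_condDistrib
      (f := fun q : Y × X => embeddingReal X q.2)
      (he.measurable.comp measurable_snd).stronglyMeasurable).measurable
  · filter_upwards [Measure.ae_ae_of_ae_compProd h] with x hx
    have : ∫ x', embeddingReal X x' ∂(condDistrib id π μ (π x)) = embeddingReal X x := by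
      rw [Kernel.comap_apply] at hx
      rw [integral_congr_ae (g := fun _ => embeddingReal X x)]
      · simp
      · filter_upwards [hx] with x' hx'
        rw [hx']
    simp only [this]
    exact he.leftInverse_invFun x

end Joining

/-! ### From sections to isomorphisms -/

section Section

variable {X Y : Type*} [MeasurableSpace X] [MeasurableSpace Y] [MeasurableEq X] [MeasurableEq Y]

/-- The isomorphism relates the sets on which `s ∘ π` and `π ∘ s` are the identity. -/
lemma exists_measurableEquiv_of_section {π : X → Y} (hπm : Measurable π) {μ : Measure X}
    [IsProbabilityMeasure μ] {s : Y → X} (hs : Measurable s) (h : ∀ᵐ x ∂μ, s (π x) = x) :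
    ∃ (A : Set X) (B : Set Y), MeasurableSet A ∧ MeasurableSet B ∧
      μ A = 1 ∧ (μ.map π) B = 1 ∧ ∃ e : A ≃ᵐ B, ∀ x : A, (e x : Y) = π x := by
  have hA : MeasurableSet {x | s (π x) = x} := measurableSet_eq_fun (hs.comp hπm) measurable_id
  have hB : MeasurableSet {y | π (s y) = y} := measurableSet_eq_fun (hπm.comp hs) measurable_id
  refine ⟨_, _, hA, hB, (prob_compl_eq_zero_iff hA).1 (ae_iff.1 h), ?_, ?_, ?_⟩
  · rw [Measure.map_apply hπm hB, ← prob_compl_eq_zero_iff (hπm hB)]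
    have : ∀ᵐ x ∂μ, π (s (π x)) = π x := by
      filter_upwards [h] with x hx
      rw [hx]
    exact ae_iff.1 this
  · exact
      { toFun := fun x => ⟨π x, congrArg π x.2⟩
        invFun := fun y => ⟨s y, congrArg s y.2⟩
        left_inv := fun x => Subtype.ext x.2
        right_inv := fun y => Subtype.ext y.2
        measurable_toFun := (hπm.comp measurable_subtype_coe).subtype_mk
        measurable_invFun := (hs.comp measurable_subtype_coe).subtype_mk }
  · exact fun _ => rfl

end Section

lemma IsBanachProximalMap.isTopoIsomorphic {G X Y : Type*} [Group G] (hG : IsAmenable G)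
    [MetricSpace X] [CompactSpace X] [MeasurableSpace X] [BorelSpace X]
    [MetricSpace Y] [CompactSpace Y] [MeasurableSpace Y] [BorelSpace Y]
    [MulAction G X] [ContinuousConstSMul G X] [MulAction G Y] [ContinuousConstSMul G Y]
    {π : X → Y} (hπ : IsFactorMap G π) (h : IsBanachProximalMap G π) :
    IsTopoIsomorphic G π := by
  intro μ hμ hinv
  have hπm : Measurable π := hπ.continuous.measurable
  have : Nonempty X := nonempty_of_isProbabilityMeasure μ
  have := smulInvariantMeasure_relIndepJoining hπm hπ.map_smul μ
  have hprox : ∀ᵐ p ∂(relIndepJoining hπm μ), BanachProximal G p.1 p.2 := by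
    filter_upwards [ae_relIndepJoining_map_eq hπm μ] with p hp using h _ _ hp
  obtain ⟨s, hs, hsπ⟩ := exists_measurable_section_of_joining_diagonal hπm
    (ae_eq_of_ae_banachProximal hG hprox)
  exact exists_measurableEquiv_of_section hπm hs hsπ

end WeylFactor

theorem mainTheorem1 {G X Y : Type*} [Group G] [Countable G] (hG : WeylFactor.IsAmenable G)
    [MetricSpace X] [CompactSpace X] [MeasurableSpace X] [BorelSpace X]
    [MetricSpace Y] [CompactSpace Y] [MeasurableSpace Y] [BorelSpace Y]
    [MulAction G X] [ContinuousConstSMul G X] [MulAction G Y] [ContinuousConstSMul G Y]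
    (π : X → Y) (hπ : WeylFactor.IsFactorMap G π) :
    List.TFAE
      [WeylFactor.IsTopoIsomorphic G π,
        WeylFactor.IsBanachProximalMap G π,
        ∀ x x' : X, WeylFactor.BanachProximal G (π x) (π x') →
          WeylFactor.BanachProximal G x x'] := by
  tfae_have 1 → 3 := fun h x x' hxx => h.banachProximal_of_map hπ hxx
  tfae_have 3 → 2 := fun h x x' hxx =>
    h x x' (hxx ▸ WeylFactor.banachProximal_self (π x))
  tfae_have 2 → 1 := fun h => h.isTopoIsomorphic hG hπ
  tfae_finish
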